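/- Let $a,b\ge 0$ be integers. Encode a word over $\{0,1\}$ as a lattice path starting at $(0,0)$, where $0$ is a horizontal and $1$ a vertical unit step; a word with Parikh vector $(a,b)$ ($a$ occurrences of $0$ and $b$ occurrences of $1$) encodes a path from $(0,0)$ to $(a,b)$. The best approximation from below of a curve joining $(0,0)$ to $(a,b)$ is the word with Parikh vector $(a,b)$ whose path does not go above the curve and is the uppermost path with this property. A word with Parikh vector $(a,b)$ is (upward) digitally convex if it is the best approximation from below of some upward convex curve that joins $(0,0)$ to $(a,b)$ and is contained in the rectangle $[0,a]\times[0,b]$ (that is, a possibly trivial vertical segment from $(0,0)$ to $(0,f(0))$ followed by the graph of a continuous concave function $f:[0,a]\to[0,b]$ with $f(a)=b$). The lower Christoffel word $w_{a,b}$ is the best approximation from below of the Euclidean segment from $(0,0)$ to $(a,b)$. An inflation changes a digitally convex word $u01v$ into $u10v$, provided that $u10v$ is again digitally convex; a deflation changes a digitally convex word $u10v$ into $u01v$, provided that $u01v$ is again digitally convex. Theorem. (i) The words that can be reached from $w_{a,b}$ by a finite (possibly empty) sequence of inflations are exactly the digitally convex words with Parikh vector $(a,b)$. (ii) The words that can be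 reached from $1^b0^a$ by a finite (possibly empty) sequence of deflations are exactly the digitally convex words with Parikh vector $(a,b)$. -/

import Mathlib

/-- Binary words, over the alphabet `{0, 1}`. -/
abbrev BinWord : Type := List (Fin 2)

namespace BinWord

/-- The word `w` has Parikh vector `(a, b)`: `a` occurrences of `0` and `b` occurrences of `1`. -/
def HasParikh (a b : ℕ) (w : BinWord) : Prop :=
  w.count 0 = a ∧ w.count 1 = b

/-- The lattice point reached from `(0, 0)` by the path of `p`, where `0` is a horizontal and `1`
is a vertical unit step. -/
def endpoint (p : BinWord) : ℝ × ℝ :=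
  ((p.count 0 : ℝ), (p.count 1 : ℝ))

/-- The points of the plane that lie on or below the curve `C`. -/
def onOrBelow (C : Set (ℝ × ℝ)) : Set (ℝ × ℝ) :=
  {p | ∃ q ∈ C, q.1 = p.1 ∧ p.2 ≤ q.2}

/-- The path encoded by `w` stays (weakly) below the curve `C`. For the curves considered below,
which are graphs of nondecreasing functions (possibly after an initial vertical segment), it is the
same to ask this of the vertices of the path or of all its points. -/
def LiesBelow (C : Set (ℝ × ℝ)) (w : BinWord) : Prop :=
  ∀ p : BinWord, p <+: w → endpoint p ∈ onOrBelow C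

/-- Dominance: every prefix of `v` has at least as many `1`s as the prefix of `u` of the same
length. For words with the same Parikh vector, the path of `u` is weakly below the path of `v`. -/
def DominatedBy (u v : BinWord) : Prop :=
  ∀ k : ℕ, (u.take k).count 1 ≤ (v.take k).count 1

/-- `w` is the best approximation from below of the curve `C` joining `(0, 0)` to `(a, b)`: its path
joins `(0, 0)` to `(a, b)` without crossing `C`, and it is the uppermost path with this property. -/
def IsBestApproxBelow (a b : ℕ) (C : Set (ℝ × ℝ)) (w : BinWord) : Prop :=
  HasParikh a b w ∧ LiesBelow C w ∧
    ∀ v : BinWord, HasParikh a b v → LiesBelow C v → DominatedBy v w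

/-- `C` is an upward convex curve that joins `(0, 0)` to `(a, b)` and is contained in the rectangle
`[0, a] × [0, b]`: a (possibly trivial) vertical segment from `(0, 0)` to `(0, f 0)`, followed by
the graph over `[0, a]` of a continuous concave function `f`. -/
def IsUpwardConvexCurve (a b : ℕ) (C : Set (ℝ × ℝ)) : Prop :=
  ∃ f : ℝ → ℝ,
    ContinuousOn f (Set.Icc 0 (a : ℝ)) ∧
    ConcaveOn ℝ (Set.Icc 0 (a : ℝ)) f ∧
    (∀ x ∈ Set.Icc 0 (a : ℝ), f x ∈ Set.Icc 0 (b : ℝ)) ∧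
    f a = b ∧
    C = {p | p.1 = 0 ∧ p.2 ∈ Set.Icc 0 (f 0)} ∪ {p | p.1 ∈ Set.Icc 0 (a : ℝ) ∧ p.2 = f p.1}

/-- (Upward) digitally convex words. -/
def DigitallyConvex (w : BinWord) : Prop :=
  ∃ C : Set (ℝ × ℝ), IsUpwardConvexCurve (w.count 0) (w.count 1) C ∧
    IsBestApproxBelow (w.count 0) (w.count 1) C w

/-- The Euclidean segment from `(0, 0)` to `(a, b)`. -/
def euclideanSegment (a b : ℕ) : Set (ℝ × ℝ) :=
  segment ℝ ((0 : ℝ), (0 : ℝ)) ((a : ℝ), (b : ℝ))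

theorem length_eq_count (w : BinWord) : w.length = w.count 0 + w.count 1 := by
  induction w with
  | nil => rfl
  | cons x t ih =>
    fin_cases x <;> simp [ih] <;> omega

theorem eq_of_dominatedBy {u v : BinWord} (h : u.length = v.length)
    (huv : DominatedBy u v) (hvu : DominatedBy v u) : u = v := by
  have key : ∀ k, (u.take k).count 1 = (v.take k).count 1 :=
    fun k => le_antisymm (huv k) (hvu k)
  refine List.ext_getElem h fun i hi hi' => ?_
  have h1 := key (i + 1)
  have h2 := key i
  rw [List.take_add_one, List.take_add_one, List.getElem?_eq_getElem hi,
    List.getElem?_eq_getElem hi', List.count_append, List.count_append, h2] at h1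
  generalize u[i] = x at h1
  generalize v[i] = y at h1
  fin_cases x <;> fin_cases y <;> simp at h1 ⊢

theorem endpoint_mem_segment_iff {a b : ℕ} {p : BinWord}
    (h0 : p.count 0 ≤ a) (h1 : p.count 1 ≤ b) :
    endpoint p ∈ onOrBelow (euclideanSegment a b) ↔ a * p.count 1 ≤ b * p.count 0 := by
  unfold onOrBelow euclideanSegment endpoint
  rw [segment_eq_image']
  simp only [Set.mem_ofPred_eq, Set.mem_image, Set.mem_Icc]
  have h0' : (p.count 0 : ℝ) ≤ a := by exact_mod_cast h0
  have h1' : (p.count 1 : ℝ) ≤ b := by exact_mod_cast h1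
  constructor
  · rintro ⟨q, ⟨t, ⟨ht0, ht1⟩, rfl⟩, hx, hy⟩
    simp at hx hy
    have : (a : ℝ) * p.count 1 ≤ b * p.count 0 := by
      rw [← hx]
      nlinarith [mul_le_mul_of_nonneg_left hy (Nat.cast_nonneg a : (0 : ℝ) ≤ a)]
    exact_mod_cast this
  · intro h
    have h' : (a : ℝ) * p.count 1 ≤ b * p.count 0 := by exact_mod_cast h
    rcases Nat.eq_zero_or_pos a with rfl | ha
    · refine ⟨_, ⟨1, ⟨zero_le_one, le_rfl⟩, rfl⟩, ?_, ?_⟩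
      · have : p.count 0 = 0 := by omega
        simp [this]
      · simpa using h1'
    · have ha' : (0 : ℝ) < a := by exact_mod_cast ha
      refine ⟨_, ⟨(p.count 0 : ℝ) / a, ⟨by positivity, (div_le_one ha').2 h0'⟩, rfl⟩, ?_, ?_⟩
      · simp [ha'.ne']
      · simp only [Prod.mk_sub_mk, sub_zero, Prod.smul_mk, smul_eq_mul, Prod.mk_add_mk, zero_add]
        rw [div_mul_eq_mul_div, le_div_iff₀ ha']
        linarith

/-- There is exactly one best approximation from below of the segment. -/
theorem existsUnique_isBestApproxBelow_segment (a b : ℕ) :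
    ∃! w : BinWord, IsBestApproxBelow a b (euclideanSegment a b) w := by
  set n := a + b with hn
  set c : BinWord :=
    (List.range n).map (fun k => if b * (k + 1) / n = b * k / n then 0 else 1) with hc
  have hlen : c.length = n := by simp [hc]
  have hstep : ∀ k, k < n → b * k / n ≤ b * (k + 1) / n ∧ b * (k + 1) / n ≤ b * k / n + 1 := by
    intro k hk
    refine ⟨Nat.div_le_div_right (by nlinarith), ?_⟩
    have hpos : 0 < n := by omega
    rw [← Nat.add_div_right _ hpos]
    exact Nat.div_le_div_right (by nlinarith)
  have hcount : ∀ k, k ≤ n → (c.take k).count 1 = b * k / n := by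
    intro k
    induction k with
    | zero => simp
    | succ k ih =>
      intro hk
      have hk' : k < c.length := by omega
      rw [List.take_add_one, List.getElem?_eq_getElem hk', List.count_append, ih (by omega)]
      have hs := hstep k (by omega)
      simp only [hc, List.getElem_map, List.getElem_range]
      split_ifs with h
      · simp [h]
      · simp
        omega
  have hone : c.count 1 = b := by
    have h := hcount n le_rfl
    rw [List.take_of_length_le hlen.le] at h
    rcases Nat.eq_zero_or_pos n with h0 | h0
    · have : b = 0 := by omega
      simp [h, this]
    · rw [h, Nat.mul_div_cancel _ h0]
  have hzero : c.count 0 = a := by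
    have := length_eq_count c
    omega
  have hbest : IsBestApproxBelow a b (euclideanSegment a b) c := by
    refine ⟨⟨hzero, hone⟩, ?_, ?_⟩
    · intro p hp
      have hp0 := hp.sublist.count_le 0
      have hp1 := hp.sublist.count_le 1
      rw [endpoint_mem_segment_iff (by omega) (by omega)]
      have hl := hp.length_le
      have h := hcount p.length (by omega)
      rw [← List.prefix_iff_eq_take.1 hp] at h
      have h2 : p.count 1 * n ≤ b * p.length := by
        rw [h]; exact Nat.div_mul_le_self _ _
      rw [length_eq_count p, hn] at h2
      nlinarith
    · intro v hv hvC k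
      have hvl : v.length = n := by
        have := length_eq_count v
        have := hv.1
        have := hv.2
        omega
      have main : ∀ k, k ≤ n → (v.take k).count 1 ≤ (c.take k).count 1 := by
        intro k hk
        rw [hcount k hk]
        rcases Nat.eq_zero_or_pos n with h0 | h0
        · have : k = 0 := by omega
          simp [this]
        have hp : v.take k <+: v := List.take_prefix k v
        have hp0 := hp.sublist.count_le 0
        have hp1 := hp.sublist.count_le 1
        have h := hvC _ hp
        rw [endpoint_mem_segment_iff (by have := hv.1; omega) (by have := hv.2; omega)] at h
        have hl := length_eq_count (v.take k)
        rw [List.length_take, hvl, min_eq_left hk] at hl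
        rw [Nat.le_div_iff_mul_le h0, hn]
        conv_rhs => rw [hl]
        nlinarith
      rcases le_total k n with hk | hk
      · exact main k hk
      · have h := main n le_rfl
        rw [List.take_of_length_le hvl.le, List.take_of_length_le hlen.le] at h
        rwa [List.take_of_length_le (by omega), List.take_of_length_le (by omega)]
  refine ⟨c, hbest, fun w hw => ?_⟩
  have hwl : w.length = c.length := by
    have := length_eq_count w
    have := hw.1.1
    have := hw.1.2
    omega
  exact eq_of_dominatedBy hwl (hbest.2.2 w hw.1 hw.2.1) (hw.2.2 c hbest.1 hbest.2.1)

/-- The lower Christoffel word `w_{a,b}`: the best approximation from below of the Euclidean segment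
joining `(0, 0)` to `(a, b)`. -/
noncomputable def lowerChristoffel (a b : ℕ) : BinWord :=
  (existsUnique_isBestApproxBelow_segment a b).choose

/-- One inflation: an occurrence of `01` in a digitally convex word is changed into `10`, and the
result is still digitally convex. -/
def Inflation (w w' : BinWord) : Prop :=
  DigitallyConvex w ∧ DigitallyConvex w' ∧
    ∃ u v : BinWord, w = u ++ [0, 1] ++ v ∧ w' = u ++ [1, 0] ++ v

/-- One deflation: an occurrence of `10` in a digitally convex word is changed into `01`, and the
result is still digitally convex. -/
def Deflation (w w' : BinWord) : Prop :=
  DigitallyConvex w ∧ DigitallyConvex w' ∧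
    ∃ u v : BinWord, w = u ++ [1, 0] ++ v ∧ w' = u ++ [0, 1] ++ v

end BinWord

/-!
A path with Parikh vector `(a, b)` is recorded by its column heights `h 0 ≤ … ≤ h a = b`, where
`h i` is the largest ordinate that it reaches on the vertical line of abscissa `i`
(`BinWord.height`). A word lies below the curve of a function `f` exactly when `h i ≤ f i` for all
`i`, so a word is digitally convex exactly when `h i = ⌊f i⌋` for some concave `f` as in the
definition of an upward convex curve (`digitallyConvex_iff`). An inflation increases one height
by `1` and a deflation decreases one height by `1`. As the two moves are inverse to each other, it
is enough to show that every digitally convex word other than the Christoffel word has a deflation,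
and that every digitally convex word other than `1 ^ b 0 ^ a` has an inflation; the sum of the
heights then serves as the induction parameter.

*Deflation* (`exists_inflation_to`). If the word is not the Christoffel word, then some point
`(i, h i)` is above the segment from `(0, 0)` to `(a, b)`. Take the first `i` for which the distance
to the segment is maximal. A line of slope slightly larger than `b / a` passes through `(i, h i)`
and strictly above all the other points `(m, h m)`. Shift it down a little and replace `f` by its
minimum with this line: the integer part changes at `i` only, where it drops by `1`.

*Inflation* (`exists_inflation_from`). Move `f` linearly to the constant `b` and stop as soon as
some `⌊f i⌋` jumps. Several columns may jump at the same time; let `i` be the last one. Tilt the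
function slightly around `i`, adding `ε (x - i)`, so that the columns before `i` fall back below
their jump, and truncate it at `b`. Now the integer part has changed at `i` only.
-/

open Set

namespace BinWord

/-! ### Column heights -/

/-- The number of `1`s that precede the `(i + 1)`-st `0` of a word (the number of all `1`s if there
is no such `0`): the largest ordinate that the path reaches at abscissa `i`. -/
def height : BinWord → ℕ → ℕ
  | [], _ => 0
  | x :: w, i => if x = 0 then (match i with | 0 => 0 | j + 1 => height w j) else height w i + 1

@[simp] theorem height_nil (i : ℕ) : height [] i = 0 := rfl

@[simp] theorem height_zero_cons_zero (w : BinWord) : height (0 :: w) 0 = 0 := rfl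

@[simp] theorem height_zero_cons_succ (w : BinWord) (i : ℕ) :
    height (0 :: w) (i + 1) = height w i := rfl

@[simp] theorem height_one_cons (w : BinWord) (i : ℕ) :
    height (1 :: w) i = height w i + 1 := rfl

theorem height_of_count_le {w : BinWord} {i : ℕ} (h : w.count 0 ≤ i) :
    height w i = w.count 1 := by
  induction w generalizing i with
  | nil => simp
  | cons x t ih =>
    fin_cases x
    · cases i with
      | zero => simp at h
      | succ i => simpa using ih (by simpa using h)
    · simpa using ih (by simpa using h)

theorem height_le_count (w : BinWord) (i : ℕ) : height w i ≤ w.count 1 := by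
  induction w generalizing i with
  | nil => simp
  | cons x t ih =>
    fin_cases x
    · cases i with
      | zero => simp
      | succ i => simpa using ih i
    · simpa using ih i

theorem count_le_height_of_prefix {p w : BinWord} (h : p <+: w) :
    p.count 1 ≤ height w (p.count 0) := by
  obtain ⟨q, rfl⟩ := h
  induction p with
  | nil => simp
  | cons x t ih => fin_cases x <;> simpa using ih

theorem height_le_count_of_prefix {p w : BinWord} (h : p <+: w) {i : ℕ} (hi : i < p.count 0) :
    height w i ≤ p.count 1 := by
  obtain ⟨q, rfl⟩ := h
  induction p generalizing i with
  | nil => simp at hi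
  | cons x t ih =>
    fin_cases x
    · cases i with
      | zero => simp
      | succ i => simpa using ih (by simpa using hi)
    · simpa using ih (by simpa using hi)

theorem exists_prefix_height {w : BinWord} {i : ℕ} (hi : i ≤ w.count 0) :
    ∃ p : BinWord, p <+: w ∧ p.count 0 = i ∧ p.count 1 = height w i := by
  induction w generalizing i with
  | nil => exact ⟨[], List.prefix_rfl, by simpa [eq_comm] using hi, by simp⟩
  | cons x t ih =>
    fin_cases x
    · cases i with
      | zero => exact ⟨[], List.nil_prefix, by simp, by simp⟩
      | succ i =>
        obtain ⟨p, hp, h0, h1⟩ := ih (i := i) (by simpa using hi)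
        exact ⟨0 :: p, by simpa using hp, by simp [h0], by simp [h1]⟩
    · obtain ⟨p, hp, h0, h1⟩ := ih (i := i) (by simpa using hi)
      exact ⟨1 :: p, by simpa using hp, by simp [h0], by simp [h1]⟩

theorem HasParikh.length_eq {a b : ℕ} {w : BinWord} (h : HasParikh a b w) :
    w.length = a + b := by
  rw [length_eq_count, h.1, h.2]

theorem dominatedBy_of_height_le {a b : ℕ} {v w : BinWord} (hv : HasParikh a b v)
    (hw : HasParikh a b w) (h : ∀ i ≤ a, height v i ≤ height w i) : DominatedBy v w := by
  intro k
  by_contra! hlt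
  have hvp := List.take_prefix k v
  have hwp := List.take_prefix k w
  have lv := length_eq_count (v.take k)
  have lw := length_eq_count (w.take k)
  rw [List.length_take, hv.length_eq] at lv
  rw [List.length_take, hw.length_eq] at lw
  -- The prefix of `v` has more `1`s and fewer `0`s than the prefix of `w` of the same length.
  have h1 := height_le_count_of_prefix hwp (i := (v.take k).count 0) (by omega)
  have h2 := count_le_height_of_prefix hvp
  have h3 := hvp.sublist.count_le 0
  have h4 := h _ (h3.trans hv.1.le)
  omega

/-! ### Elementary moves -/

theorem height_append (u v : BinWord) (i : ℕ) :
    height (u ++ v) (u.count 0 + i) = u.count 1 + height v i := by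
  induction u with
  | nil => simp
  | cons x t ih =>
    fin_cases x
    · simpa [Nat.add_right_comm] using ih
    · simpa [Nat.add_right_comm] using ih

theorem height_append_of_lt {u : BinWord} {i : ℕ} (hi : i < u.count 0) (v v' : BinWord) :
    height (u ++ v) i = height (u ++ v') i := by
  induction u generalizing i with
  | nil => simp at hi
  | cons x t ih =>
    fin_cases x
    · cases i with
      | zero => simp
      | succ i => simpa using ih (by simpa using hi)
    · simpa using ih (by simpa using hi)

theorem height_swap (u v : BinWord) (m : ℕ) :
    height (u ++ [1, 0] ++ v) m
      = height (u ++ [0, 1] ++ v) m + if m = u.count 0 then 1 else 0 := by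
  rw [List.append_assoc, List.append_assoc]
  rcases lt_or_ge m (u.count 0) with h | h
  · rw [if_neg h.ne, add_zero]
    exact height_append_of_lt h _ _
  · obtain ⟨j, rfl⟩ := Nat.exists_eq_add_of_le h
    rw [height_append, height_append]
    cases j with
    | zero => simp
    | succ j => simp

theorem count_swap (u v : BinWord) (x : Fin 2) :
    (u ++ [1, 0] ++ v).count x = (u ++ [0, 1] ++ v).count x := by
  fin_cases x <;> simp

theorem exists_eq_append_zero_one {w : BinWord} {i : ℕ} (h : height w i < height w (i + 1)) :
    ∃ u v : BinWord, w = u ++ [0, 1] ++ v ∧ u.count 0 = i := by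
  induction w generalizing i with
  | nil => simp at h
  | cons x t ih =>
    fin_cases x
    · cases i with
      | zero =>
        -- A positive height in column `0` forces the rest of the word to start with `1`.
        match t, h with
        | [], h => simp at h
        | 0 :: s, h => simp at h
        | 1 :: s, h => exact ⟨[], s, rfl, by simp⟩
      | succ i =>
        obtain ⟨u, v, rfl, hu⟩ := ih (i := i) (by simpa using h)
        exact ⟨0 :: u, v, rfl, by simp [hu]⟩
    · obtain ⟨u, v, rfl, hu⟩ := ih (i := i) (by simpa using h)
      exact ⟨1 :: u, v, rfl, by simpa using hu⟩

theorem exists_eq_append_one_zero {w : BinWord} {i : ℕ} (hi : i < w.count 0)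
    (hpos : 0 < height w i) (h : ∀ j < i, height w j < height w i) :
    ∃ u v : BinWord, w = u ++ [1, 0] ++ v ∧ u.count 0 = i := by
  induction w generalizing i with
  | nil => simp at hi
  | cons x t ih =>
    fin_cases x
    · cases i with
      | zero => simp at hpos
      | succ i =>
        obtain ⟨u, v, rfl, hu⟩ := ih (i := i) (by simpa using hi)
          (by simpa using h 0 (Nat.succ_pos _))
          (fun j hj => by simpa using h (j + 1) (by omega))
        exact ⟨0 :: u, v, rfl, by simp [hu]⟩
    · have h' : ∀ j < i, height t j < height t i := fun j hj => by simpa using h j hj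
      have hi' : i < t.count 0 := by simpa using hi
      rcases Nat.eq_zero_or_pos (height t i) with h0 | h0
      · have hi0 : i = 0 := by
          by_contra hne
          have := h' 0 (by omega)
          omega
        subst hi0
        match t, hi', h0 with
        | [], hi', _ => simp at hi'
        | 0 :: s, _, _ => exact ⟨[], s, rfl, by simp⟩
        | 1 :: s, _, h0 => simp at h0
      · obtain ⟨u, v, rfl, hu⟩ := ih hi' h0 h'
        exact ⟨1 :: u, v, rfl, by simpa using hu⟩

/-! ### Concave profiles -/

/-- The functions whose graphs, preceded by a vertical segment, are the upward convex curves from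
`(0, 0)` to `(a, b)`. -/
structure IsProfile (a b : ℕ) (f : ℝ → ℝ) : Prop where
  continuousOn : ContinuousOn f (Icc 0 (a : ℝ))
  concaveOn : ConcaveOn ℝ (Icc 0 (a : ℝ)) f
  mem_Icc : ∀ x ∈ Icc 0 (a : ℝ), f x ∈ Icc 0 (b : ℝ)
  apply_right : f a = b

/-- The upward convex curve of a function: the vertical segment from `(0, 0)` to `(0, f 0)`
followed by the graph. -/
def profileCurve (a : ℕ) (f : ℝ → ℝ) : Set (ℝ × ℝ) :=
  {p | p.1 = 0 ∧ p.2 ∈ Icc 0 (f 0)} ∪ {p | p.1 ∈ Icc 0 (a : ℝ) ∧ p.2 = f p.1}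

theorem isUpwardConvexCurve_iff {a b : ℕ} {C : Set (ℝ × ℝ)} :
    IsUpwardConvexCurve a b C ↔ ∃ f, IsProfile a b f ∧ C = profileCurve a f :=
  ⟨fun ⟨f, h1, h2, h3, h4, h5⟩ => ⟨f, ⟨h1, h2, h3, h4⟩, h5⟩,
    fun ⟨f, ⟨h1, h2, h3, h4⟩, h5⟩ => ⟨f, h1, h2, h3, h4, h5⟩⟩

theorem natCast_mem_Icc {a m : ℕ} (hm : m ≤ a) : (m : ℝ) ∈ Icc 0 (a : ℝ) :=
  ⟨m.cast_nonneg, by exact_mod_cast hm⟩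

/-- Nonnegativity of a concave function has to be checked at the left end only, since the value at
the right end is `b`. -/
theorem IsProfile.of_le {a b : ℕ} {f : ℝ → ℝ} (hc : ContinuousOn f (Icc 0 (a : ℝ)))
    (hf : ConcaveOn ℝ (Icc 0 (a : ℝ)) f) (hle : ∀ x ∈ Icc 0 (a : ℝ), f x ≤ b)
    (h0 : 0 ≤ f 0) (ha : f a = b) : IsProfile a b f where
  continuousOn := hc
  concaveOn := hf
  mem_Icc x hx := ⟨(le_min h0 (by rw [ha]; positivity)).trans
    (hf.min_le_of_mem_Icc (left_mem_Icc.2 a.cast_nonneg) (right_mem_Icc.2 a.cast_nonneg) hx),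
    hle x hx⟩
  apply_right := ha

theorem IsProfile.mono {a b : ℕ} {f : ℝ → ℝ} (hf : IsProfile a b f) {m n : ℕ} (hmn : m ≤ n)
    (hn : n ≤ a) : f m ≤ f n := by
  have hm := natCast_mem_Icc (hmn.trans hn)
  have h := hf.concaveOn.min_le_of_mem_Icc hm (right_mem_Icc.2 a.cast_nonneg)
    (z := (n : ℝ)) ⟨by exact_mod_cast hmn, by exact_mod_cast hn⟩
  rw [hf.apply_right, min_eq_left (hf.mem_Icc _ hm).2] at h
  exact h

theorem endpoint_mem_onOrBelow_profileCurve {a : ℕ} {f : ℝ → ℝ} {p : BinWord}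
    (hp : p.count 0 ≤ a) :
    endpoint p ∈ onOrBelow (profileCurve a f) ↔ (p.count 1 : ℝ) ≤ f (p.count 0) := by
  constructor
  · rintro ⟨q, ⟨h0, h1⟩ | ⟨-, h1⟩, hx, hy⟩
    · simp only [endpoint] at hx hy
      rw [← hx, h0]
      exact hy.trans h1.2
    · simp only [endpoint] at hx hy
      rw [← hx, ← h1]
      exact hy
  · intro h
    exact ⟨(p.count 0, f (p.count 0)), Or.inr ⟨natCast_mem_Icc hp, rfl⟩, rfl, h⟩

theorem liesBelow_profileCurve_iff {a : ℕ} {f : ℝ → ℝ} {w : BinWord}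
    (hw : w.count 0 = a) :
    LiesBelow (profileCurve a f) w ↔ ∀ i ≤ a, (height w i : ℝ) ≤ f i := by
  constructor
  · intro h i hi
    obtain ⟨p, hp, h0, h1⟩ := exists_prefix_height (w := w) (i := i) (by omega)
    have := (endpoint_mem_onOrBelow_profileCurve (by omega)).1 (h p hp)
    rwa [h0, h1] at this
  · intro h p hp
    have hle : p.count 0 ≤ a := (hp.sublist.count_le 0).trans hw.le
    rw [endpoint_mem_onOrBelow_profileCurve hle]
    exact le_trans (by exact_mod_cast count_le_height_of_prefix hp) (h _ hle)

/-- The uppermost path below a profile is the one whose heights are the integer parts of the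
profile. -/
theorem isBestApproxBelow_profileCurve_iff {a b : ℕ} {f : ℝ → ℝ} (hf : IsProfile a b f)
    {w : BinWord} (hw : HasParikh a b w) :
    IsBestApproxBelow a b (profileCurve a f) w ↔
      ∀ i ≤ a, (height w i : ℝ) ≤ f i ∧ f i < height w i + 1 := by
  constructor
  · rintro ⟨-, hbelow, hbest⟩ i hi
    rw [liesBelow_profileCurve_iff hw.1] at hbelow
    refine ⟨hbelow i hi, ?_⟩
    by_contra! hlt
    -- In the last column where the path could be raised, raising it gives a higher path.
    obtain ⟨j, hj, hjmax⟩ := ((Finset.range (a + 1)).filter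
      (fun j => (height w j : ℝ) + 1 ≤ f j)).exists_maximal
        ⟨i, by simpa using ⟨by omega, hlt⟩⟩
    simp only [Finset.mem_filter, Finset.mem_range] at hj hjmax
    have hja : j < a := by
      rcases (Nat.lt_succ_iff.1 hj.1).lt_or_eq with h | h
      · exact h
      · exfalso
        have h2 := hj.2
        rw [h, hf.apply_right, height_of_count_le hw.1.le, hw.2] at h2
        linarith
    have hnext : f ((j + 1 : ℕ) : ℝ) < height w (j + 1) + 1 := by
      by_contra! hcon
      have := hjmax ⟨Nat.succ_lt_succ hja, hcon⟩ (Nat.le_succ j)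
      omega
    have hstep : height w j < height w (j + 1) := by
      have h1 : (height w j : ℝ) + 1 < height w (j + 1) + 1 :=
        (hj.2.trans (hf.mono (Nat.le_succ j) hja)).trans_lt hnext
      have h2 : height w j + 1 < height w (j + 1) + 1 := by exact_mod_cast h1
      omega
    obtain ⟨u, v, rfl, hu⟩ := exists_eq_append_zero_one hstep
    have hpar : HasParikh a b (u ++ [1, 0] ++ v) := by
      rw [HasParikh, count_swap, count_swap]
      exact hw
    have hdom := hbest _ hpar <| (liesBelow_profileCurve_iff hpar.1).2 fun m hm => by
      rw [height_swap, hu]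
      split_ifs with h
      · subst h
        exact_mod_cast hj.2
      · simpa using hbelow m hm
    have := hdom (u.length + 1)
    simp [List.take_append] at this
  · intro h
    refine ⟨hw, (liesBelow_profileCurve_iff hw.1).2 fun i hi => (h i hi).1, fun v hv hvb => ?_⟩
    rw [liesBelow_profileCurve_iff hv.1] at hvb
    refine dominatedBy_of_height_le hv hw fun i hi => ?_
    have : (height v i : ℝ) < (height w i : ℝ) + 1 := (hvb i hi).trans_lt (h i hi).2
    exact Nat.lt_succ_iff.1 (by exact_mod_cast this)

theorem digitallyConvex_iff {a b : ℕ} {w : BinWord} (hw : HasParikh a b w) :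
    DigitallyConvex w ↔ ∃ f, IsProfile a b f ∧
      ∀ i ≤ a, (height w i : ℝ) ≤ f i ∧ f i < height w i + 1 := by
  unfold DigitallyConvex
  rw [hw.1, hw.2]
  constructor
  · rintro ⟨C, hC, hbest⟩
    obtain ⟨f, hf, rfl⟩ := isUpwardConvexCurve_iff.1 hC
    exact ⟨f, hf, (isBestApproxBelow_profileCurve_iff hf hw).1 hbest⟩
  · rintro ⟨f, hf, h⟩
    exact ⟨_, isUpwardConvexCurve_iff.2 ⟨f, hf, rfl⟩,
      (isBestApproxBelow_profileCurve_iff hf hw).2 h⟩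

/-! ### The two extreme words -/

theorem lowerChristoffel_spec (a b : ℕ) :
    IsBestApproxBelow a b (euclideanSegment a b) (lowerChristoffel a b) :=
  (existsUnique_isBestApproxBelow_segment a b).choose_spec.1

theorem liesBelow_euclideanSegment_iff {a b : ℕ} {w : BinWord} (hw : HasParikh a b w) :
    LiesBelow (euclideanSegment a b) w ↔ ∀ i ≤ a, a * height w i ≤ b * i := by
  constructor
  · intro h i hi
    obtain ⟨p, hp, h0, h1⟩ := exists_prefix_height (w := w) (i := i) (hi.trans hw.1.ge)
    have := (endpoint_mem_segment_iff ((hp.sublist.count_le 0).trans hw.1.le)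
      ((hp.sublist.count_le 1).trans hw.2.le)).1 (h p hp)
    rwa [h0, h1] at this
  · intro h p hp
    have hp0 := (hp.sublist.count_le 0).trans hw.1.le
    rw [endpoint_mem_segment_iff hp0 ((hp.sublist.count_le 1).trans hw.2.le)]
    exact (Nat.mul_le_mul_left a (count_le_height_of_prefix hp)).trans (h _ hp0)

/-- The segment from `(0, 0)` to `(a, b)` as the graph of a function. For `a = 0` the quotient
`b / 0` is `0`, and the function is the constant `b`, whose curve is the vertical segment. -/
theorem isProfile_segment (a b : ℕ) : IsProfile a b (fun x => b + (b / a : ℝ) * (x - a)) := by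
  have hb : (0 : ℝ) ≤ b := b.cast_nonneg
  have hs : (0 : ℝ) ≤ b / a := by positivity
  refine .of_le (by fun_prop) ⟨convex_Icc _ _, fun x _ y _ s t _ _ hst => ?_⟩ (fun x hx => ?_) ?_
    (by simp)
  · obtain rfl : s = 1 - t := by linarith
    simp only [smul_eq_mul]
    exact le_of_eq (by ring)
  · nlinarith [mul_nonneg hs (sub_nonneg.2 hx.2)]
  · rcases eq_or_ne (a : ℝ) 0 with h | h
    · simp [h]
    · refine le_of_eq ?_
      field_simp
      ring

theorem liesBelow_segment_profile_iff {a b : ℕ} {w : BinWord} (hw : HasParikh a b w) :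
    LiesBelow (profileCurve a fun x => b + (b / a : ℝ) * (x - a)) w ↔
      LiesBelow (euclideanSegment a b) w := by
  rw [liesBelow_profileCurve_iff hw.1, liesBelow_euclideanSegment_iff hw]
  refine forall₂_congr fun i hi => ?_
  rcases Nat.eq_zero_or_pos a with rfl | ha
  · have := height_le_count w i
    rw [hw.2] at this
    simpa using this
  · have ha' : (0 : ℝ) < a := by exact_mod_cast ha
    have : (b : ℝ) + b / a * (i - a) = b * i / a := by field_simp; ring
    rw [this, le_div_iff₀ ha']
    norm_cast
    rw [mul_comm]

theorem digitallyConvex_lowerChristoffel (a b : ℕ) : DigitallyConvex (lowerChristoffel a b) := by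
  obtain ⟨hw, hb, hbest⟩ := lowerChristoffel_spec a b
  refine (digitallyConvex_iff hw).2 ⟨_, isProfile_segment a b,
    (isBestApproxBelow_profileCurve_iff (isProfile_segment a b) hw).1 ⟨hw, ?_, ?_⟩⟩
  · exact (liesBelow_segment_profile_iff hw).2 hb
  · exact fun v hv hvb => hbest v hv ((liesBelow_segment_profile_iff hv).1 hvb)

/-- A concave profile lies above its chord, so the Christoffel word is the lowest digitally convex
word. -/
theorem eq_lowerChristoffel_of_liesBelow {a b : ℕ} {w : BinWord} (hw : HasParikh a b w)
    (hconv : DigitallyConvex w) (hbelow : LiesBelow (euclideanSegment a b) w) :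
    w = lowerChristoffel a b := by
  obtain ⟨hc, hcb, hbest⟩ := lowerChristoffel_spec a b
  refine eq_of_dominatedBy (by rw [hw.length_eq, hc.length_eq]) (hbest w hw hbelow) ?_
  obtain ⟨f, hf, hfw⟩ := (digitallyConvex_iff hw).1 hconv
  refine dominatedBy_of_height_le hc hw fun i hi => ?_
  have h1 := (liesBelow_euclideanSegment_iff hc).1 hcb i hi
  have h1' : (a : ℝ) * height (lowerChristoffel a b) i ≤ b * i := by exact_mod_cast h1
  have h2 : (height (lowerChristoffel a b) i : ℝ) ≤ f i := by
    rcases Nat.eq_zero_or_pos a with rfl | ha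
    · obtain rfl : i = 0 := by omega
      rw [hf.apply_right]
      exact_mod_cast (height_le_count _ _).trans hc.2.le
    · have ha' : (0 : ℝ) < a := by exact_mod_cast ha
      have hi' : (i : ℝ) ≤ a := by exact_mod_cast hi
      have h := hf.concaveOn.2 (left_mem_Icc.2 ha'.le) (right_mem_Icc.2 ha'.le)
        (show (0 : ℝ) ≤ 1 - i / a from sub_nonneg.2 ((div_le_one ha').2 hi'))
        (show (0 : ℝ) ≤ i / a by positivity) (by ring)
      simp only [smul_eq_mul, mul_zero, zero_add, div_mul_cancel₀ _ ha'.ne', hf.apply_right] at h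
      have h0 : 0 ≤ (1 - (i : ℝ) / a) * f 0 :=
        mul_nonneg (sub_nonneg.2 ((div_le_one ha').2 hi')) (hf.mem_Icc _ (left_mem_Icc.2 ha'.le)).1
      have h3 : (height (lowerChristoffel a b) i : ℝ) ≤ i / a * b := by
        rw [div_mul_eq_mul_div, le_div_iff₀ ha']
        linarith
      linarith
  have h3 : (height (lowerChristoffel a b) i : ℝ) < (height w i : ℝ) + 1 :=
    h2.trans_lt (hfw i hi).2
  exact Nat.lt_succ_iff.1 (by exact_mod_cast h3)

theorem hasParikh_replicate (a b : ℕ) :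
    HasParikh a b (List.replicate b 1 ++ List.replicate a 0) := by
  constructor <;> simp [List.count_replicate]

theorem height_replicate {a b i : ℕ} :
    height (List.replicate b 1 ++ List.replicate a 0) i = b := by
  have h1 := height_le_count (List.replicate b 1 ++ List.replicate a 0) i
  rw [(hasParikh_replicate a b).2] at h1
  have h2 := height_append (List.replicate b 1) (List.replicate a 0) i
  simp [List.count_replicate] at h2
  omega

theorem digitallyConvex_replicate (a b : ℕ) :
    DigitallyConvex (List.replicate b 1 ++ List.replicate a 0) :=
  (digitallyConvex_iff (hasParikh_replicate a b)).2 ⟨fun _ => b,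
    .of_le continuousOn_const (concaveOn_const _ (convex_Icc _ _)) (fun _ _ => le_rfl)
      b.cast_nonneg rfl, fun i _ => by simp [height_replicate]⟩

theorem eq_replicate_of_height {a b : ℕ} {w : BinWord} (hw : HasParikh a b w)
    (h : ∀ i ≤ a, height w i = b) : w = List.replicate b 1 ++ List.replicate a 0 := by
  have hr := hasParikh_replicate a b
  refine eq_of_dominatedBy (by rw [hw.length_eq, hr.length_eq])
    (dominatedBy_of_height_le hw hr fun i hi => ?_) (dominatedBy_of_height_le hr hw fun i hi => ?_)
  · rw [h i hi, height_replicate]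
  · rw [h i hi, height_replicate]

/-! ### Existence of moves -/

theorem exists_first_max {α : Type*} [LinearOrder α] (n : ℕ) (F : ℕ → α) :
    ∃ i ≤ n, (∀ m ≤ n, F m ≤ F i) ∧ ∀ m < i, F m < F i := by
  obtain ⟨j, hj, hmax⟩ := (Finset.range (n + 1)).exists_max_image F ⟨0, by simp⟩
  simp only [Finset.mem_range, Nat.lt_succ_iff] at hj hmax
  have hex : ∃ k, k ≤ n ∧ F k = F j := ⟨j, hj, rfl⟩
  classical
  obtain ⟨h1, h2⟩ := Nat.find_spec hex
  refine ⟨Nat.find hex, h1, fun m hm => (hmax m hm).trans h2.ge, fun m hm => ?_⟩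
  have hmn : m ≤ n := by omega
  rw [h2]
  exact (hmax m hmn).lt_of_ne fun h => Nat.find_min hex hm ⟨hmn, h⟩

theorem exists_last_max {α : Type*} [LinearOrder α] {s : Finset ℕ} (hs : s.Nonempty)
    (F : ℕ → α) :
    ∃ i ∈ s, (∀ m ∈ s, F m ≤ F i) ∧ ∀ m ∈ s, i < m → F m < F i := by
  obtain ⟨j, hj, hmax⟩ := s.exists_max_image F hs
  obtain ⟨i, hi, himax⟩ := (s.filter (fun k => F k = F j)).exists_max_image id
    ⟨j, by simpa using hj⟩
  simp only [Finset.mem_filter, id] at hi himax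
  refine ⟨i, hi.1, fun m hm => (hmax m hm).trans hi.2.ge, fun m hm him => ?_⟩
  rw [hi.2]
  exact (hmax m hm).lt_of_ne fun h => absurd (himax m ⟨hm, h⟩) (by omega)

/-- A profile whose integer parts are the heights of `w` lowered by `1` in column `i` gives a
digitally convex word from which `w` is obtained by an inflation. -/
theorem exists_inflation_to_of_profile {a b i : ℕ} {w : BinWord} (hw : HasParikh a b w)
    (hconv : DigitallyConvex w) (hi : i < a) {g : ℝ → ℝ} (hg : IsProfile a b g)
    (hne : ∀ m ≤ a, m ≠ i → (height w m : ℝ) ≤ g m ∧ g m < height w m + 1)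
    (hgi : (height w i : ℝ) ≤ g i + 1 ∧ g i < height w i) :
    ∃ w', HasParikh a b w' ∧ Inflation w' w ∧
      ∀ m, height w m = height w' m + if m = i then 1 else 0 := by
  have hpos : 0 < height w i := by
    have : (0 : ℝ) < height w i := (hg.mem_Icc _ (natCast_mem_Icc hi.le)).1.trans_lt hgi.2
    exact_mod_cast this
  have hlt : ∀ j < i, height w j < height w i := fun j hj => by
    have : (height w j : ℝ) < height w i :=
      ((hne j (by omega) hj.ne).1.trans (hg.mono hj.le hi.le)).trans_lt hgi.2
    exact_mod_cast this
  obtain ⟨u, v, rfl, hu⟩ := exists_eq_append_one_zero (by rw [hw.1]; exact hi) hpos hlt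
  have hpar : HasParikh a b (u ++ [0, 1] ++ v) := by
    rw [HasParikh, ← count_swap, ← count_swap]
    exact hw
  have hh := height_swap u v
  rw [hu] at hh
  refine ⟨_, hpar, ⟨(digitallyConvex_iff hpar).2 ⟨g, hg, fun m hm => ?_⟩, hconv, u, v, rfl, rfl⟩,
    hh⟩
  rcases eq_or_ne m i with rfl | hmi
  · rw [hh m] at hgi
    simp only [if_true, Nat.cast_add, Nat.cast_one] at hgi
    exact ⟨by linarith, hgi.2⟩
  · have := hne m hm hmi
    rwa [hh m, if_neg hmi, add_zero] at this

/-- A profile whose integer parts are the heights of `w` raised by `1` in column `i` gives an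
inflation of `w`. -/
theorem exists_inflation_from_of_profile {a b i : ℕ} {w : BinWord} (hw : HasParikh a b w)
    (hconv : DigitallyConvex w) (hi : i < a) {g : ℝ → ℝ} (hg : IsProfile a b g)
    (hne : ∀ m ≤ a, m ≠ i → (height w m : ℝ) ≤ g m ∧ g m < height w m + 1)
    (hgi : (height w i : ℝ) + 1 ≤ g i ∧ g i < height w i + 2) :
    ∃ w', HasParikh a b w' ∧ Inflation w w' ∧
      ∀ m, height w' m = height w m + if m = i then 1 else 0 := by
  have hlt : height w i < height w (i + 1) := by
    have h : (height w i : ℝ) + 1 < height w (i + 1) + 1 :=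
      (hgi.1.trans (hg.mono (Nat.le_succ i) hi)).trans_lt (hne (i + 1) hi (by omega)).2
    have h' : height w i + 1 < height w (i + 1) + 1 := by exact_mod_cast h
    omega
  obtain ⟨u, v, rfl, hu⟩ := exists_eq_append_zero_one hlt
  have hpar : HasParikh a b (u ++ [1, 0] ++ v) := by
    rw [HasParikh, count_swap, count_swap]
    exact hw
  have hh := height_swap u v
  rw [hu] at hh
  refine ⟨_, hpar, ⟨hconv, (digitallyConvex_iff hpar).2 ⟨g, hg, fun m hm => ?_⟩, u, v, rfl, rfl⟩,
    hh⟩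
  rw [hh m]
  rcases eq_or_ne m i with rfl | hmi
  · simp only [if_true, Nat.cast_add, Nat.cast_one]
    exact ⟨hgi.1, by linarith [hgi.2]⟩
  · simpa [if_neg hmi] using hne m hm hmi

theorem concaveOn_line (s : Set ℝ) (hs : Convex ℝ s) (c d : ℝ) :
    ConcaveOn ℝ s (fun x => c + d * x) := by
  refine ⟨hs, fun x _ y _ p q _ _ hpq => ?_⟩
  obtain rfl : p = 1 - q := by linarith
  simp only [smul_eq_mul]
  exact le_of_eq (by ring)

theorem exists_inflation_to {a b : ℕ} {w : BinWord} (hw : HasParikh a b w)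
    (hconv : DigitallyConvex w) (hne : w ≠ lowerChristoffel a b) :
    ∃ w', HasParikh a b w' ∧ ∃ i < a, Inflation w' w ∧
      ∀ m, height w m = height w' m + if m = i then 1 else 0 := by
  obtain ⟨f, hf, hfw⟩ := (digitallyConvex_iff hw).1 hconv
  obtain ⟨i, hia, hmax, hfirst⟩ := exists_first_max a fun m => (a * height w m - b * m : ℤ)
  have hpos : (0 : ℤ) < a * height w i - b * i := by
    by_contra! hcon
    refine hne (eq_lowerChristoffel_of_liesBelow hw hconv
      ((liesBelow_euclideanSegment_iff hw).2 fun m hm => ?_))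
    have := (hmax m hm).trans hcon
    zify
    linarith
  have hlast : height w a = b := by rw [height_of_count_le hw.1.le, hw.2]
  have hi : i < a := by
    refine hia.lt_of_ne fun h => ?_
    rw [h, hlast] at hpos
    linarith [mul_comm (a : ℤ) b]
  have ha : (0 : ℝ) < a := by exact_mod_cast (Nat.zero_le i).trans_lt hi
  have hhi : (1 : ℝ) ≤ height w i := by
    rcases Nat.eq_zero_or_pos (height w i) with h | h
    · rw [h] at hpos
      have : (0 : ℤ) ≤ b * i := by positivity
      simp at hpos
      linarith
    · exact_mod_cast h
  -- With this `ε`, a line through `(i, h i)` of slope `b / a + ε` still passes at least `ε` above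
  -- the other points, since the points before `i` are at least `1 / a` below the parallel to the
  -- segment through `(i, h i)`.
  set ε : ℝ := 1 / (a * (a + 1)) with hε
  have hεpos : 0 < ε := by positivity
  have hε1 : (1 : ℝ) / a = (a + 1) * ε := by rw [hε]; field_simp
  have hεle : ε ≤ 1 := by
    have h1 : (1 : ℝ) ≤ a := by exact_mod_cast (Nat.zero_le i).trans_lt hi
    rw [hε, div_le_one (by positivity)]
    nlinarith
  set ℓ : ℝ → ℝ := fun x => (height w i - (b / a + ε) * i - ε) + (b / a + ε) * x with hℓ
  have hℓi : ℓ i = height w i - ε := by simp only [hℓ]; ring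
  have hℓne : ∀ m ≤ a, m ≠ i → (height w m : ℝ) ≤ ℓ m := by
    intro m hm hmi
    have hm' : (m : ℝ) ≤ a := by exact_mod_cast hm
    have hia' : (i : ℝ) ≤ a := by exact_mod_cast hia
    rcases hmi.lt_or_gt with h | h
    · have h1 := Int.add_one_le_iff.2 (hfirst m h)
      have h2 : (a * height w m - b * m + 1 : ℝ) ≤ a * height w i - b * i := by exact_mod_cast h1
      have h3 : (1 : ℝ) / a ≤ height w i - height w m + b / a * (m - i) := by
        rw [div_le_iff₀ ha]
        field_simp
        linarith
      rw [hε1] at h3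
      have h4 : ε * (i - m) ≤ ε * a :=
        mul_le_mul_of_nonneg_left (by linarith [(m.cast_nonneg : (0 : ℝ) ≤ m)]) hεpos.le
      simp only [hℓ]
      linarith
    · have h2 : (a * height w m - b * m : ℝ) ≤ a * height w i - b * i := by
        exact_mod_cast hmax m hm
      have h3 : (0 : ℝ) ≤ height w i - height w m + b / a * (m - i) := by
        have : (height w i - height w m + b / a * (m - i) : ℝ)
            = (a * height w i - b * i - (a * height w m - b * m)) / a := by
          field_simp
          ring
        rw [this]
        exact div_nonneg (by linarith) ha.le
      have h4 : ε * 1 ≤ ε * (m - i) := by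
        have : (i + 1 : ℝ) ≤ m := by exact_mod_cast h
        exact mul_le_mul_of_nonneg_left (by linarith) hεpos.le
      simp only [hℓ]
      linarith
  have hg : IsProfile a b (fun x => min (f x) (ℓ x)) := by
    refine .of_le (hf.continuousOn.inf (by fun_prop))
      (hf.concaveOn.inf (concaveOn_line _ (convex_Icc _ _) _ _))
      (fun x hx => (min_le_left _ _).trans (hf.mem_Icc x hx).2)
      (le_min (hf.mem_Icc 0 (left_mem_Icc.2 ha.le)).1 ?_) ?_
    · rcases Nat.eq_zero_or_pos i with h | h
      · have : ℓ 0 = height w i - ε := by rw [← hℓi, h, Nat.cast_zero]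
        rw [this]
        linarith
      · have := hℓne 0 (Nat.zero_le _) h.ne
        rw [Nat.cast_zero] at this
        exact le_trans (Nat.cast_nonneg _) this
    · have := hℓne a le_rfl hi.ne'
      rw [hlast] at this
      simp only [hf.apply_right]
      exact min_eq_left this
  have hgi : min (f i) (ℓ i) = height w i - ε := by
    rw [hℓi]
    exact min_eq_right (by linarith [(hfw i hia).1])
  obtain ⟨w', h1, h2, h3⟩ := exists_inflation_to_of_profile hw hconv hi hg
    (fun m hm hmi => ⟨le_min (hfw m hm).1 (hℓne m hm hmi), min_lt_of_left_lt (hfw m hm).2⟩)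
    (by simp only [hgi]; constructor <;> linarith)
  exact ⟨w', h1, i, hi, h2, h3⟩

theorem exists_pos_mul_lt (n : ℕ) (δ : ℕ → ℝ) (hδ : ∀ m ≤ n, 0 < δ m) :
    ∃ ε > 0, ∀ m ≤ n, ε * n < δ m := by
  obtain ⟨k, hk, hmin⟩ := (Finset.range (n + 1)).exists_min_image δ ⟨0, by simp⟩
  simp only [Finset.mem_range, Nat.lt_succ_iff] at hk hmin
  have hpos := hδ k hk
  refine ⟨δ k / (n + 1), by positivity, fun m hm => lt_of_lt_of_le ?_ (hmin m hm)⟩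
  rw [div_mul_eq_mul_div, div_lt_iff₀ (by positivity)]
  nlinarith

theorem exists_inflation_from {a b : ℕ} {w : BinWord} (hw : HasParikh a b w)
    (hconv : DigitallyConvex w) (hne : w ≠ List.replicate b 1 ++ List.replicate a 0) :
    ∃ w', HasParikh a b w' ∧ ∃ i < a, Inflation w w' ∧
      ∀ m, height w' m = height w m + if m = i then 1 else 0 := by
  obtain ⟨f, hf, hfw⟩ := (digitallyConvex_iff hw).1 hconv
  have hle : ∀ m, height w m ≤ b := fun m => (height_le_count w m).trans hw.2.le
  have hlast : height w a = b := by rw [height_of_count_le hw.1.le, hw.2]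
  have hfle : ∀ m ≤ a, f m ≤ b := fun m hm => (hf.mem_Icc _ (natCast_mem_Icc hm)).2
  have hlow : ∀ m ≤ a, height w m < b → f m < b := fun m hm h =>
    (hfw m hm).2.trans_le (by exact_mod_cast h)
  have htop : ∀ m ≤ a, ¬ height w m < b → f m = b := fun m hm h => by
    have h1 : height w m = b := le_antisymm (hle m) (not_lt.1 h)
    refine le_antisymm (hfle m hm) ?_
    have := (hfw m hm).1
    rwa [h1] at this
  have hS : ((Finset.range (a + 1)).filter (fun m => height w m < b)).Nonempty := by
    by_contra hcon
    refine hne (eq_replicate_of_height hw fun i hi => le_antisymm (hle i) ?_)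
    by_contra! hlt
    exact hcon ⟨i, by simpa using ⟨by omega, hlt⟩⟩
  -- Along the homotopy `b - r (b - f)`, where `r` decreases from `1` to `0`, the integer part in
  -- column `m` jumps when `r` is the following quotient.
  obtain ⟨i, hiS, hmax, hlastmax⟩ := exists_last_max hS
    fun m => ((b - height w m - 1) / (b - f m) : ℝ)
  simp only [Finset.mem_filter, Finset.mem_range, Nat.lt_succ_iff] at hiS hmax hlastmax
  obtain ⟨hia, hib⟩ := hiS
  have hi : i < a := hia.lt_of_ne fun h => by rw [h, hlast] at hib; exact lt_irrefl _ hib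
  have hden : ∀ m ≤ a, height w m < b → (0 : ℝ) < b - f m :=
    fun m hm h => sub_pos.2 (hlow m hm h)
  have hdi := hden i hia hib
  set r : ℝ := (b - height w i - 1) / (b - f i) with hr
  have hr0 : 0 ≤ r := by
    have : (height w i + 1 : ℝ) ≤ b := by exact_mod_cast hib
    exact div_nonneg (by linarith) hdi.le
  have hr1 : r < 1 := by
    rw [hr, div_lt_one hdi]
    linarith [(hfw i hia).2]
  have hgi : b - r * (b - f i) = height w i + 1 := by
    rw [hr, div_mul_cancel₀ _ hdi.ne']
    ring
  have hup : ∀ m ≤ a, b - r * (b - f m) ≤ height w m + 1 := by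
    intro m hm
    by_cases h : height w m < b
    · have := hmax m ⟨hm, h⟩
      rw [div_le_iff₀ (hden m hm h)] at this
      linarith
    · have h1 : height w m = b := le_antisymm (hle m) (not_lt.1 h)
      rw [htop m hm h, h1]
      linarith
  have hup' : ∀ m ≤ a, i < m → b - r * (b - f m) < height w m + 1 := by
    intro m hm him
    by_cases h : height w m < b
    · have := hlastmax m ⟨hm, h⟩ him
      rw [div_lt_iff₀ (hden m hm h)] at this
      linarith
    · have h1 : height w m = b := le_antisymm (hle m) (not_lt.1 h)
      rw [htop m hm h, h1]
      linarith
  have hge : ∀ m ≤ a, (height w m : ℝ) ≤ b - r * (b - f m) := by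
    intro m hm
    have h1 := (hfw m hm).1
    nlinarith [mul_nonneg (sub_nonneg.2 hr1.le) (sub_nonneg.2 (hfle m hm))]
  have hgt : ∀ m < i, (height w m : ℝ) < b - r * (b - f m) := by
    intro m hmi
    have hm : m ≤ a := by omega
    have h1 := (hfw m hm).1
    have h2 : f m < b := (hf.mono hmi.le hia).trans_lt (hlow i hia hib)
    nlinarith [mul_pos (sub_pos.2 hr1) (sub_pos.2 h2)]
  obtain ⟨ε, hε, hεlt⟩ := exists_pos_mul_lt a
    (fun m => if m < i then (b - r * (b - f m)) - height w m
      else if m = i then 1 else height w m + 1 - (b - r * (b - f m))) (by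
    intro m hm
    split_ifs with h h'
    · exact sub_pos.2 (hgt m h)
    · exact one_pos
    · exact sub_pos.2 (hup' m hm (by omega)))
  have hia' : (i : ℝ) ≤ a := by exact_mod_cast hia
  set g : ℝ → ℝ := fun x => min (b : ℝ) (b - r * (b - f x) + ε * (x - i)) with hgdef
  have hgne : ∀ m ≤ a, m ≠ i → (height w m : ℝ) ≤ g m ∧ g m < height w m + 1 := by
    intro m hm hmi
    have hm' : (m : ℝ) ≤ a := by exact_mod_cast hm
    have hm0 : (0 : ℝ) ≤ m := m.cast_nonneg
    have hi0 : (0 : ℝ) ≤ i := i.cast_nonneg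
    have hεm := hεlt m hm
    have hb : (height w m : ℝ) ≤ b := by exact_mod_cast hle m
    rcases hmi.lt_or_gt with h | h
    · rw [if_pos h] at hεm
      have h' : (m : ℝ) < i := by exact_mod_cast h
      have h1 : ε * (i - m) ≤ ε * a := mul_le_mul_of_nonneg_left (by linarith) hε.le
      have h2 : 0 < ε * (i - m) := mul_pos hε (sub_pos.2 h')
      refine ⟨le_min hb (by linarith), min_lt_of_right_lt ?_⟩
      linarith [hup m hm]
    · rw [if_neg (by omega), if_neg hmi] at hεm
      have h' : (i : ℝ) < m := by exact_mod_cast h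
      have h1 : ε * (m - i) ≤ ε * a := mul_le_mul_of_nonneg_left (by linarith) hε.le
      have h2 : 0 < ε * (m - i) := mul_pos hε (sub_pos.2 h')
      exact ⟨le_min hb (by linarith [hge m hm]), min_lt_of_right_lt (by linarith)⟩
  have hgi' : g i = height w i + 1 := by
    simp only [hgdef, hgi, sub_self, mul_zero, add_zero]
    exact min_eq_right (by exact_mod_cast hib)
  have hg : IsProfile a b g := by
    refine .of_le ?_ ?_ (fun x _ => min_le_left _ _) ?_ ?_
    · have := hf.continuousOn
      exact continuousOn_const.inf (by fun_prop)
    · refine (concaveOn_const _ (convex_Icc _ _)).inf ?_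
      have h := (hf.concaveOn.smul hr0).add
        (concaveOn_line (Icc 0 (a : ℝ)) (convex_Icc _ _) (b - r * b - ε * i) ε)
      refine h.congr fun x _ => ?_
      simp only [Pi.add_apply, smul_eq_mul]
      ring
    · rcases Nat.eq_zero_or_pos i with h | h
      · have : g 0 = height w i + 1 := by rw [← hgi', h, Nat.cast_zero]
        rw [this]
        positivity
      · have := (hgne 0 (Nat.zero_le _) h.ne).1
        rw [Nat.cast_zero] at this
        exact le_trans (Nat.cast_nonneg _) this
    · simp only [hgdef, hf.apply_right, sub_self, mul_zero, sub_zero]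
      exact min_eq_left (le_add_of_nonneg_right (mul_nonneg hε.le (sub_nonneg.2 hia')))
  obtain ⟨w', h1, h2, h3⟩ := exists_inflation_from_of_profile hw hconv hi hg hgne
    (by rw [hgi']; constructor <;> linarith)
  exact ⟨w', h1, i, hi, h2, h3⟩

/-! ### Reachability -/

theorem sum_height_lt {a i : ℕ} {w w' : BinWord} (hi : i < a)
    (h : ∀ m, height w' m = height w m + if m = i then 1 else 0) :
    ∑ m ∈ Finset.range a, height w m < ∑ m ∈ Finset.range a, height w' m := by
  refine Finset.sum_lt_sum (fun m _ => by rw [h m]; exact Nat.le_add_right _ _)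
    ⟨i, Finset.mem_range.2 hi, by rw [h i, if_pos rfl]; exact Nat.lt_succ_self _⟩

theorem sum_height_le {a b : ℕ} {w : BinWord} (hw : HasParikh a b w) :
    ∑ m ∈ Finset.range a, height w m ≤ a * b := by
  have := Finset.sum_le_card_nsmul (Finset.range a) (height w) b
    fun m _ => (height_le_count w m).trans hw.2.le
  simpa using this

theorem Inflation.deflation {w w' : BinWord} (h : Inflation w w') : Deflation w' w :=
  let ⟨h1, h2, u, v, hu, hv⟩ := h
  ⟨h2, h1, u, v, hv, hu⟩

theorem Inflation.hasParikh {a b : ℕ} {w w' : BinWord} (h : Inflation w w')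
    (hw : HasParikh a b w) : HasParikh a b w' := by
  obtain ⟨-, -, u, v, rfl, rfl⟩ := h
  rw [HasParikh, count_swap, count_swap]
  exact hw

theorem Deflation.hasParikh {a b : ℕ} {w w' : BinWord} (h : Deflation w w')
    (hw : HasParikh a b w) : HasParikh a b w' := by
  obtain ⟨-, -, u, v, rfl, rfl⟩ := h
  rw [HasParikh, ← count_swap, ← count_swap]
  exact hw

theorem reflTransGen_inflation {a b : ℕ} {w : BinWord} (hw : HasParikh a b w)
    (hconv : DigitallyConvex w) : Relation.ReflTransGen Inflation (lowerChristoffel a b) w := by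
  induction hn : ∑ m ∈ Finset.range a, height w m using Nat.strong_induction_on generalizing w with
  | _ n ih =>
    by_cases h : w = lowerChristoffel a b
    · rw [h]
    · obtain ⟨w', hw', i, hi, hinf, hh⟩ := exists_inflation_to hw hconv h
      exact (ih _ (hn ▸ sum_height_lt hi hh) hw' hinf.1 rfl).tail hinf

theorem reflTransGen_deflation {a b : ℕ} {w : BinWord} (hw : HasParikh a b w)
    (hconv : DigitallyConvex w) :
    Relation.ReflTransGen Deflation (List.replicate b 1 ++ List.replicate a 0) w := by
  induction hn : a * b - ∑ m ∈ Finset.range a, height w m using Nat.strong_induction_on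
    generalizing w with
  | _ n ih =>
    by_cases h : w = List.replicate b 1 ++ List.replicate a 0
    · rw [h]
    · obtain ⟨w', hw', i, hi, hinf, hh⟩ := exists_inflation_from hw hconv h
      have h1 := sum_height_lt hi hh
      have h2 := sum_height_le hw'
      exact (ih _ (by omega) hw' hinf.2.1 rfl).tail hinf.deflation

end BinWord

theorem mainTheorem1 (a b : ℕ) :
    (∀ w : BinWord,
      Relation.ReflTransGen BinWord.Inflation (BinWord.lowerChristoffel a b) w ↔
        BinWord.DigitallyConvex w ∧ BinWord.HasParikh a b w) ∧
    (∀ w : BinWord,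
      Relation.ReflTransGen BinWord.Deflation (List.replicate b 1 ++ List.replicate a 0) w ↔
        BinWord.DigitallyConvex w ∧ BinWord.HasParikh a b w) := by
  refine ⟨fun w => ⟨fun h => ?_, fun h => BinWord.reflTransGen_inflation h.2 h.1⟩,
    fun w => ⟨fun h => ?_, fun h => BinWord.reflTransGen_deflation h.2 h.1⟩⟩
  · induction h with
    | refl =>
      exact ⟨BinWord.digitallyConvex_lowerChristoffel a b, (BinWord.lowerChristoffel_spec a b).1⟩
    | tail _ hstep ih => exact ⟨hstep.2.1, hstep.hasParikh ih.2⟩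
  · induction h with
    | refl => exact ⟨BinWord.digitallyConvex_replicate a b, BinWord.hasParikh_replicate a b⟩
    | tail _ hstep ih => exact ⟨hstep.2.1, hstep.hasParikh ih.2⟩
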